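/- Let $\mathbb{K}$ be $\mathbb{R}$ or $\mathbb{C}$, let $X$ be an infinite-dimensional Banach space over $\mathbb{K}$ with dual $X'$, and let $0<p\le s<\infty$. Consider the following spaces of $X$-valued sequences. - $\ell_p(X)$ is the set of all $(x_n)$ with $\sum_n\|x_n\|^p<\infty$. - For $0<q<\infty$, $\ell_q^w(X)$ is the space of all $(x_n)$ with $\sum_n|\varphi(x_n)|^q<\infty$ for every $\varphi\in X'$, with the norm ($q$-norm if $q<1$) $\|(x_n)\|_{w,q}=\sup_{\|\varphi\|\le1}\big(\sum_n|\varphi(x_n)|^q\big)^{1/q}$. - $\ell_p^u(X)$ is the space of all $(x_n)\in\ell_p^w(X)$ with $\lim_{n\to\infty}\|(x_j)_{j\ge n}\|_{w,p}=0$, with the norm ($p$-norm if $p<1$) $\|\cdot\|_{w,p}$. - $\ell_{m(s;p)}(X)$ is the space of all $(x_n)$ that can be written as $x_n=\tau_ny_n$ for all $n$, with $(\tau_n)\in\ell_r$ and $(y_n)\in\ell_s^w(X)$, where $r\in(0,\infty]$ is given by $\frac1r+\frac1s=\frac1p$. Its norm ($p$-norm if $p<1$) is the infimum of $\|(\tau_n)\|_r\,\|(y_n)\|_{w,s}$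 over all such representations. A subset $A$ of a Banach or quasi-Banach space $E$ is called spaceable if $A\cup\{0\}$ contains a closed infinite-dimensional linear subspace of $E$. Then 1. $\ell_{m(s;p)}(X)-\ell_p(X)$ is spaceable (in $\ell_{m(s;p)}(X)$); 2. $\ell_p^u(X)-\ell_p(X)$ is spaceable (in $\ell_p^u(X)$); 3. consequently, $\ell_p^w(X)-\ell_p(X)$ is spaceable (in $\ell_p^w(X)$). Here $-$ denotes set difference. -/

import Mathlib

open Filter Topology
open scoped ENNReal

noncomputable section

namespace SeqSpace

/-- The (quasi-)norm of a scalar sequence in `ℓ_q`, `0 < q ≤ ∞`, with values in `[0, ∞]`. -/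
def scalarNorm {𝕜 : Type*} [RCLike 𝕜] (q : ℝ≥0∞) (a : ℕ → 𝕜) : ℝ≥0∞ :=
  if q = ∞ then ⨆ n, ‖a n‖ₑ
  else (∑' n, ‖a n‖ₑ ^ q.toReal) ^ (1 / q.toReal)

/-- `ℓ_q(X)`: the absolutely `q`-summable `X`-valued sequences (bounded ones for `q = ∞`). -/
def ell (q : ℝ≥0∞) (X : Type*) [NormedAddCommGroup X] : Set (ℕ → X) :=
  {x | Memℓp x q}

/-- `ℓ_q^w(X)`: the weakly `q`-summable `X`-valued sequences. -/
def weakEll (𝕜 : Type*) [RCLike 𝕜] (q : ℝ≥0∞) (X : Type*) [NormedAddCommGroup X]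
    [NormedSpace 𝕜 X] : Set (ℕ → X) :=
  {x | ∀ φ : X →L[𝕜] 𝕜, Memℓp (fun n => φ (x n)) q}

/-- The usual (quasi-)norm of `ℓ_q^w(X)`: the supremum over the closed unit ball of the dual. -/
def weakNorm (𝕜 : Type*) [RCLike 𝕜] (q : ℝ≥0∞) {X : Type*} [NormedAddCommGroup X]
    [NormedSpace 𝕜 X] (x : ℕ → X) : ℝ≥0∞ :=
  ⨆ (φ : X →L[𝕜] 𝕜) (_ : ‖φ‖ ≤ 1), scalarNorm q (fun n => φ (x n))

/-- `ℓ_q^u(X)`: the unconditionally `q`-summable `X`-valued sequences, that is, the weakly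
`q`-summable ones whose tails tend to zero in the norm of `ℓ_q^w(X)`. Its norm is that of
`ℓ_q^w(X)`. -/
def uncondEll (𝕜 : Type*) [RCLike 𝕜] (q : ℝ≥0∞) (X : Type*) [NormedAddCommGroup X]
    [NormedSpace 𝕜 X] : Set (ℕ → X) :=
  {x | x ∈ weakEll 𝕜 q X ∧
    Tendsto (fun n => weakNorm 𝕜 q (fun j => x (n + j))) atTop (𝓝 0)}

/-- The exponent `r ∈ (0, ∞]` with `1 / r + 1 / s = 1 / p`, for `0 < p ≤ s ≤ ∞`. -/
def mixedExponent (s p : ℝ≥0∞) : ℝ≥0∞ := (p⁻¹ - s⁻¹)⁻¹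

theorem mixedExponent_spec {s p : ℝ≥0∞} (h : p ≤ s) :
    (mixedExponent s p)⁻¹ + s⁻¹ = p⁻¹ := by
  rw [mixedExponent, inv_inv, tsub_add_cancel_of_le (ENNReal.inv_le_inv.2 h)]

/-- `x = τ · y` (coordinatewise) with `τ ∈ ℓ_r`, `y ∈ ℓ_s^w(X)` and `1 / r + 1 / s = 1 / p`. -/
def IsMixedFactorization (𝕜 : Type*) [RCLike 𝕜] (s p : ℝ≥0∞) {X : Type*}
    [NormedAddCommGroup X] [NormedSpace 𝕜 X] (x : ℕ → X) (τ : ℕ → 𝕜) (y : ℕ → X) : Prop :=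
  τ ∈ ell (mixedExponent s p) 𝕜 ∧ y ∈ weakEll 𝕜 s X ∧ ∀ n, x n = τ n • y n

/-- `ℓ_{m(s;p)}(X)`: the mixed `(s,p)`-summable `X`-valued sequences. -/
def mixedEll (𝕜 : Type*) [RCLike 𝕜] (s p : ℝ≥0∞) (X : Type*) [NormedAddCommGroup X]
    [NormedSpace 𝕜 X] : Set (ℕ → X) :=
  {x | ∃ (τ : ℕ → 𝕜) (y : ℕ → X), IsMixedFactorization 𝕜 s p x τ y}

/-- The usual (quasi-)norm of `ℓ_{m(s;p)}(X)`: the infimum of `‖τ‖_r ‖y‖_{w,s}` over all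
factorizations. -/
def mixedNorm (𝕜 : Type*) [RCLike 𝕜] (s p : ℝ≥0∞) {X : Type*} [NormedAddCommGroup X]
    [NormedSpace 𝕜 X] (x : ℕ → X) : ℝ≥0∞ :=
  ⨅ (τ : ℕ → 𝕜) (y : ℕ → X) (_ : IsMixedFactorization 𝕜 s p x τ y),
    scalarNorm (mixedExponent s p) τ * weakNorm 𝕜 s y

/-- `V` is closed in the space `E` of sequences for the (quasi-)norm `N`: it contains every
element of `E` that is an `N`-limit of a sequence in `V`. -/
def IsClosedIn {X : Type*} [NormedAddCommGroup X] (E : Set (ℕ → X))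
    (N : (ℕ → X) → ℝ≥0∞) (V : Set (ℕ → X)) : Prop :=
  ∀ (u : ℕ → ℕ → X) (z : ℕ → X), (∀ k, u k ∈ V) → z ∈ E →
    Tendsto (fun k => N (u k - z)) atTop (𝓝 0) → z ∈ V

/-- `A` is spaceable in the space `E` of `X`-valued sequences with (quasi-)norm `N`:
`A ∪ {0}` contains a closed infinite-dimensional linear subspace of `E`. -/
def Spaceable (𝕜 : Type*) [RCLike 𝕜] {X : Type*} [NormedAddCommGroup X] [NormedSpace 𝕜 X]
    (E : Set (ℕ → X)) (N : (ℕ → X) → ℝ≥0∞) (A : Set (ℕ → X)) : Prop :=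
  ∃ V : Submodule 𝕜 (ℕ → X), (V : Set (ℕ → X)) ⊆ E ∧ ¬ FiniteDimensional 𝕜 V ∧
    IsClosedIn E N (V : Set (ℕ → X)) ∧ (V : Set (ℕ → X)) ⊆ A ∪ {0}

end SeqSpace

end

/-! All three claims reduce to one family x outside ℓ_p(X). Split ℕ into infinitely many copies of
its index set and let V consist of the sequences in E that are, on every copy, a scalar multiple of
x (`spaceable_sdiff_ell`). The copies of x are independent; a nonzero element of V contains a
nonzero multiple of x, so it is not in ℓ_p(X); and V is closed because the norm dominates the
coordinates and the defining relations are coordinatewise.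

The family comes from the Dvoretzky–Rogers lemma: N vectors of norm at least 1/4 and weak 2-norm at
most 1. Scaled by N^(-β), with β = max(0, 1/s - 1/2), they have weak s-norm at most 1. After
multiplication by the further scalar N^(-1/r), the sum of p-th powers of norms is still at least
N^((1/s-β)p)/4^p, which is unbounded because β < 1/s. Blocks of this kind with geometric weights
give `exists_uniformlyWeakSummable_smul_not_summable`; the case s = p serves ℓ_p^u and ℓ_p^w. -/

namespace SeqSpace
open Module

/-! ### The Dvoretzky–Rogers lemma by determinant maximisation. -/

section DvoretzkyRogers

variable {𝕜 : Type*} [RCLike 𝕜]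

/-- The determinant of `1 + P`, for an orthogonal projection `P` of rank `k`, is `2 ^ k`. -/
theorem det_one_add_starProjection {H : Type*} [NormedAddCommGroup H] [InnerProductSpace 𝕜 H]
    [FiniteDimensional 𝕜 H] (W : Submodule 𝕜 H) :
    LinearMap.det (1 + W.starProjection.toLinearMap : H →ₗ[𝕜] H) = 2 ^ finrank 𝕜 W := by
  let e := W.prodEquivOfIsCompl _ W.isCompl_orthogonal
  let b := (finBasis 𝕜 W).prod (finBasis 𝕜 Wᗮ)
  have h : LinearMap.toMatrix b b
      (e.symm ∘ₗ (1 + W.starProjection.toLinearMap) ∘ₗ e.symm.symm) =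
      Matrix.fromBlocks ((2 : 𝕜) • 1) 0 0 1 := by
    ext (i | i) (j | j)
    · simp [LinearMap.toMatrix_apply, b, Matrix.one_apply, Finsupp.single_apply, e, eq_comm,
        Submodule.starProjection_apply]
      split_ifs <;> norm_num
    · have : W.starProjection (finBasis 𝕜 Wᗮ j : H) = 0 := by
        rw [Submodule.starProjection_apply_eq_zero_iff]; exact Subtype.mem _
      simp [LinearMap.toMatrix_apply, b, e, this]
    · simp [LinearMap.toMatrix_apply, b, e, Submodule.starProjection_apply]
    · have : W.starProjection (finBasis 𝕜 Wᗮ j : H) = 0 := by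
        rw [Submodule.starProjection_apply_eq_zero_iff]; exact Subtype.mem _
      simp [LinearMap.toMatrix_apply, b, e, this, Matrix.one_apply, Finsupp.single_apply, eq_comm]
  rw [← LinearMap.det_conj _ e.symm, ← LinearMap.det_toMatrix b, h, Matrix.det_fromBlocks_zero₂₁,
    Matrix.det_smul, Fintype.card_fin, Matrix.det_one, Matrix.det_one, mul_one, mul_one]

/-- If every subspace of at least half the dimension contains a unit vector with property `P`,
then there is an orthonormal family of such vectors of half the dimension. -/
theorem exists_orthonormal_of_forall_submodule {H : Type*} [NormedAddCommGroup H]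
    [InnerProductSpace 𝕜 H] [FiniteDimensional 𝕜 H] {P : H → Prop}
    (h : ∀ W : Submodule 𝕜 H, 0 < finrank 𝕜 W → finrank 𝕜 H ≤ 2 * finrank 𝕜 W →
      ∃ w ∈ W, ‖w‖ = 1 ∧ P w)
    (m : ℕ) (hm : 2 * m ≤ finrank 𝕜 H) :
    ∃ u : Fin m → H, Orthonormal 𝕜 u ∧ ∀ i, P (u i) := by
  induction m with
  | zero => exact ⟨Fin.elim0, ⟨fun i => i.elim0, fun i => i.elim0⟩, fun i => i.elim0⟩
  | succ m ih =>
    obtain ⟨u, hu, hP⟩ := ih (by omega)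
    have hdim := (Submodule.span 𝕜 (Set.range u)).finrank_add_finrank_orthogonal
    rw [finrank_span_eq_card hu.linearIndependent, Fintype.card_fin] at hdim
    -- Greedy choice: the complement of m vectors still has at least half the dimension, as 2(m+1) ≤
    -- dim H.
    obtain ⟨w, hw, hw1, hwP⟩ := h (Submodule.span 𝕜 (Set.range u))ᗮ (by omega) (by omega)
    refine ⟨Matrix.vecCons w u, ?_, ?_⟩
    · rw [orthonormal_vecCons_iff]
      refine ⟨hw1, fun i => ?_, hu⟩
      exact (Submodule.mem_orthogonal' _ _).1 hw _ (Submodule.subset_span ⟨i, rfl⟩)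
    · exact Fin.cases hwP hP

/-- An operator of norm at most one from an inner product space onto a normed space of the same
dimension which maximises the determinant is large on every subspace of at least half the
dimension. -/
theorem exists_opNorm_le_one_forall_submodule {H E : Type*} [NormedAddCommGroup H]
    [InnerProductSpace 𝕜 H] [FiniteDimensional 𝕜 H] [NormedAddCommGroup E] [NormedSpace 𝕜 E]
    [FiniteDimensional 𝕜 E] (L : H ≃L[𝕜] E) :
    ∃ T : H →L[𝕜] E, ‖T‖ ≤ 1 ∧ ∀ W : Submodule 𝕜 H, 0 < finrank 𝕜 W →
      finrank 𝕜 H ≤ 2 * finrank 𝕜 W → ∃ w ∈ W, ‖w‖ = 1 ∧ 1 / 4 ≤ ‖T w‖ := by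
  -- `L` serves only to turn T into an endomorphism, so that its determinant makes sense.
  let D : (H →L[𝕜] E) → ℝ := fun T => ‖((L.symm : E →L[𝕜] H).comp T).det‖
  have hD : Continuous D :=
    (ContinuousLinearMap.continuous_det.comp
      ((ContinuousLinearMap.compL 𝕜 H E H (L.symm : E →L[𝕜] H)).continuous)).norm
  have hDsmul : ∀ (c : 𝕜) T, D (c • T) = ‖c‖ ^ finrank 𝕜 H * D T := by
    intro c T
    simp only [D, ContinuousLinearMap.comp_smul]
    rw [ContinuousLinearMap.det, ContinuousLinearMap.toLinearMap_smul, LinearMap.det_smul, norm_mul,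
      norm_pow]
  have : ProperSpace (H →L[𝕜] E) := FiniteDimensional.proper 𝕜 _
  obtain ⟨T, hT, hmax⟩ := (isCompact_closedBall (0 : H →L[𝕜] E) 1).exists_isMaxOn
    ⟨0, by simp⟩ hD.continuousOn
  have hT1 : ‖T‖ ≤ 1 := by simpa using hT
  have hle : ∀ (S : H →L[𝕜] E) (c : ℝ), 0 < c → ‖S‖ ≤ c → D S ≤ c ^ finrank 𝕜 H * D T := by
    intro S c hc hS
    have h1 : D (((c⁻¹ : ℝ) : 𝕜) • S) ≤ D T := by
      apply hmax
      rw [mem_closedBall_zero_iff, norm_smul, RCLike.norm_ofReal, abs_of_pos (inv_pos.2 hc)]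
      rw [inv_mul_le_iff₀ hc, mul_one]; exact hS
    rw [hDsmul, RCLike.norm_ofReal, abs_of_pos (inv_pos.2 hc), inv_pow,
      inv_mul_le_iff₀ (pow_pos hc _)] at h1
    exact h1
  have hpos : 0 < D T := by
    have h0 : D (L : H →L[𝕜] E) = 1 := by simp [D, ContinuousLinearMap.det]
    have h1 := hle (L : H →L[𝕜] E) (‖(L : H →L[𝕜] E)‖ + 1) (by positivity) (by linarith)
    rw [h0] at h1
    by_contra hcon
    have : D T = 0 := le_antisymm (not_lt.1 hcon) (norm_nonneg _)
    rw [this] at h1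
    linarith
  refine ⟨T, hT1, fun W hW0 hW => ?_⟩
  by_contra! hcon
  have hsmall : ∀ w ∈ W, ‖T w‖ ≤ 1 / 4 * ‖w‖ := by
    intro w hw
    by_cases h0 : w = 0
    · simp [h0]
    have hn : 0 < ‖w‖ := norm_pos_iff.2 h0
    have := hcon (((‖w‖⁻¹ : ℝ) : 𝕜) • w) (W.smul_mem _ hw) (by
      rw [norm_smul, RCLike.norm_ofReal, abs_of_pos (inv_pos.2 hn), inv_mul_cancel₀ hn.ne'])
    rw [map_smul, norm_smul, RCLike.norm_ofReal, abs_of_pos (inv_pos.2 hn),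
      inv_mul_lt_iff₀ hn] at this
    linarith
  -- Perturb T to T(1 + P_W): the determinant gains 2^k, k = dim W, while the norm is at most 5/4.
  -- Maximality then gives 2^k ≤ (5/4)^(dim H) ≤ (25/16)^k, which is absurd.
  have hTP : ‖T + T.comp W.starProjection‖ ≤ 5 / 4 := by
    refine ContinuousLinearMap.opNorm_le_bound _ (by norm_num) fun v => ?_
    have h1 : ‖T v‖ ≤ 1 * ‖v‖ := T.le_of_opNorm_le hT1 v
    have h2 := hsmall _ (W.starProjection_apply_mem v)
    have h3 := W.norm_starProjection_apply_le v
    have h4 := norm_add_le (T v) (T (W.starProjection v))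
    simp only [add_apply, ContinuousLinearMap.comp_apply]
    linarith
  have hdet : D (T + T.comp W.starProjection) = D T * 2 ^ finrank 𝕜 W := by
    have : (L.symm : E →L[𝕜] H).comp (T + T.comp W.starProjection) =
        ((L.symm : E →L[𝕜] H).comp T) * (1 + W.starProjection) := by
      ext v; simp
    simp only [D]
    rw [this, ContinuousLinearMap.det, ContinuousLinearMap.toLinearMap_mul, map_mul, norm_mul]
    have := det_one_add_starProjection W
    rw [ContinuousLinearMap.toLinearMap_add, ContinuousLinearMap.toLinearMap_one, this]
    simp [ContinuousLinearMap.det]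
  have h1 := hle _ _ (by norm_num) hTP
  rw [hdet, mul_comm, mul_le_mul_iff_left₀ hpos] at h1
  have h2 : (5 / 4 : ℝ) ^ finrank 𝕜 H ≤ (5 / 4) ^ (2 * finrank 𝕜 W) :=
    pow_le_pow_right₀ (by norm_num) hW
  rw [pow_mul] at h2
  have h3 : ((5 / 4 : ℝ) ^ 2) ^ finrank 𝕜 W < 2 ^ finrank 𝕜 W :=
    pow_lt_pow_left₀ (by norm_num) (by norm_num) hW0.ne'
  linarith

/-- **Dvoretzky–Rogers lemma**: an infinite-dimensional normed space contains, for each `N`,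
`N` vectors of norm at least `1 / 4` whose weak `2`-norm is at most one. -/
theorem exists_norm_ge_forall_sum_sq_le {X : Type*} [NormedAddCommGroup X] [NormedSpace 𝕜 X]
    (hX : ¬ FiniteDimensional 𝕜 X) (N : ℕ) :
    ∃ x : Fin N → X, (∀ i, 1 / 4 ≤ ‖x i‖) ∧
      ∀ φ : X →L[𝕜] 𝕜, ∑ i, ‖φ (x i)‖ ^ 2 ≤ ‖φ‖ ^ 2 := by
  obtain ⟨f, hf⟩ : ∃ f : Fin (2 * N) → X, LinearIndependent 𝕜 f := by
    apply exists_linearIndependent_of_le_rank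
    exact (Cardinal.natCast_lt_aleph0.le).trans (not_lt.1 fun h => hX (Module.rank_lt_aleph0_iff.1 h))
  let E := Submodule.span 𝕜 (Set.range f)
  have : FiniteDimensional 𝕜 E := FiniteDimensional.span_of_finite 𝕜 (Set.finite_range f)
  let H := EuclideanSpace 𝕜 (Fin (2 * N))
  have hH : finrank 𝕜 H = 2 * N := by simp [H]
  have hE : finrank 𝕜 E = 2 * N := by simp [E, finrank_span_eq_card hf]
  obtain ⟨T, hT, hW⟩ := exists_opNorm_le_one_forall_submodule
    (ContinuousLinearEquiv.ofFinrankEq (hH.trans hE.symm) : H ≃L[𝕜] E)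
  obtain ⟨u, hu, huT⟩ := exists_orthonormal_of_forall_submodule hW N hH.ge
  refine ⟨fun i => T (u i), huT, fun φ => ?_⟩
  let ψ : H →L[𝕜] 𝕜 := φ.comp (E.subtypeL.comp T)
  have hψ : ‖ψ‖ ≤ ‖φ‖ := by
    refine ContinuousLinearMap.opNorm_le_bound _ (norm_nonneg _) fun v => ?_
    refine (φ.le_opNorm _).trans ?_
    gcongr
    have : ‖T v‖ ≤ 1 * ‖v‖ := T.le_of_opNorm_le hT v
    simpa using this
  -- Bessel's inequality for the Riesz representative of `ψ`.
  have hB := hu.sum_inner_products_le (s := Finset.univ) ((InnerProductSpace.toDual 𝕜 H).symm ψ)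
  rw [LinearIsometryEquiv.norm_map] at hB
  calc ∑ i, ‖φ (T (u i))‖ ^ 2
      = ∑ i, ‖inner 𝕜 (u i) ((InnerProductSpace.toDual 𝕜 H).symm ψ)‖ ^ 2 := by
        refine Finset.sum_congr rfl fun i _ => ?_
        rw [norm_inner_symm, InnerProductSpace.toDual_symm_apply]
        rfl
    _ ≤ ‖ψ‖ ^ 2 := hB
    _ ≤ ‖φ‖ ^ 2 := by gcongr

end DvoretzkyRogers

/-! ### Gluing finite blocks into a family outside ℓ_p. -/

section Blocks

variable {𝕜 : Type*} [RCLike 𝕜] {X : Type*} [NormedAddCommGroup X] [NormedSpace 𝕜 X]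

/-- Comparison of the `s`-norm and the `2`-norm of `N` numbers. -/
theorem sum_rpow_le_of_sum_sq_le {N : ℕ} {a : Fin N → ℝ} {A s : ℝ} (ha : ∀ i, 0 ≤ a i)
    (hA : 0 ≤ A) (hs : 0 < s) (h : ∑ i, a i ^ 2 ≤ A ^ 2) (hN : 0 < N) :
    ∑ i, a i ^ s ≤ (N : ℝ) ^ (max 0 (1 / s - 1 / 2) * s) * A ^ s := by
  have hN' : (0 : ℝ) < N := by exact_mod_cast hN
  rcases le_total s 2 with h2 | h2
  · have hp : 1 ≤ 2 / s := (one_le_div hs).2 h2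
    have hmax : max 0 (1 / s - 1 / 2) = 1 / s - 1 / 2 :=
      max_eq_right (sub_nonneg.2 (one_div_le_one_div_of_le hs h2))
    have hS : 0 ≤ ∑ i, a i ^ s := Finset.sum_nonneg fun i _ => Real.rpow_nonneg (ha i) s
    -- Power mean inequality with exponent 2/s ≥ 1.
    have h1 := Real.rpow_sum_le_const_mul_sum_rpow_of_nonneg (s := Finset.univ)
      (f := fun i => a i ^ s) hp fun i _ => Real.rpow_nonneg (ha i) s
    have h3 : ∀ i, (a i ^ s) ^ (2 / s) = a i ^ 2 := fun i => by
      rw [← Real.rpow_mul (ha i), mul_div_cancel₀ _ hs.ne', Real.rpow_two]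
    simp only [h3, Finset.card_univ, Fintype.card_fin] at h1
    have h4 : (∑ i, a i ^ s) ^ (2 / s) ≤ (N : ℝ) ^ (2 / s - 1) * A ^ 2 :=
      h1.trans (by gcongr)
    have h5 := Real.rpow_le_rpow (by positivity) h4 (by positivity : 0 ≤ s / 2)
    rw [← Real.rpow_mul hS, Real.mul_rpow (by positivity) (by positivity), ← Real.rpow_mul hN'.le,
      ← Real.rpow_two, ← Real.rpow_mul hA] at h5
    rw [hmax]
    convert h5 using 2
    · field_simp; simp
    · congr 1; field_simp
    · congr 1; field_simp
  · have hmax : max 0 (1 / s - 1 / 2) = 0 :=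
      max_eq_left (sub_nonpos.2 (one_div_le_one_div_of_le two_pos h2))
    rw [hmax, zero_mul, Real.rpow_zero, one_mul]
    have hle : ∀ i, a i ≤ A := fun i =>
      le_of_sq_le_sq ((Finset.single_le_sum (f := fun i => a i ^ 2) (fun i _ => sq_nonneg _)
        (Finset.mem_univ i)).trans h) hA
    have hsplit : ∀ b : ℝ, 0 ≤ b → b ^ s = b ^ 2 * b ^ (s - 2) := fun b hb => by
      rw [← Real.rpow_two, ← Real.rpow_add_of_nonneg hb (by norm_num) (by linarith)]
      congr 1; ring
    calc ∑ i, a i ^ s ≤ ∑ i, a i ^ 2 * A ^ (s - 2) := by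
          refine Finset.sum_le_sum fun i _ => ?_
          rw [hsplit _ (ha i)]
          gcongr
          · exact ha i
          · exact hle i
      _ = (∑ i, a i ^ 2) * A ^ (s - 2) := by rw [Finset.sum_mul]
      _ ≤ A ^ 2 * A ^ (s - 2) := by gcongr
      _ = A ^ s := (hsplit A hA).symm

/-- Finitely many vectors of weak `s`-norm at most one whose `p`-norm is arbitrarily large even
after multiplication by scalars of `r`-norm one, where `1 / r + 1 / s = 1 / p`. -/
theorem exists_weak_le_one_sum_rpow_ge (hX : ¬ FiniteDimensional 𝕜 X) {p s : ℝ} (hp : 0 < p)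
    (hps : p ≤ s) (B : ℝ) :
    ∃ N : ℕ, 0 < N ∧ ∃ v : Fin N → X,
      (∀ φ : X →L[𝕜] 𝕜, ∑ i, ‖φ (v i)‖ ^ s ≤ ‖φ‖ ^ s) ∧
      B ≤ ∑ i, ((N : ℝ) ^ (-(1 / p - 1 / s)) * ‖v i‖) ^ p := by
  have hs : 0 < s := hp.trans_le hps
  -- N^β is the norm of the identity from ℓ_2^N to ℓ_s^N.
  set β := max 0 (1 / s - 1 / 2) with hβ
  have hγ : 0 < (1 / s - β) * p := by
    refine mul_pos (sub_pos.2 (max_lt (by positivity) ?_)) hp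
    linarith
  obtain ⟨N, hN0, hNB⟩ := (((tendsto_rpow_atTop hγ).comp tendsto_natCast_atTop_atTop).eventually_ge_atTop
    (B * 4 ^ p)).and (eventually_gt_atTop 0) |>.exists.imp fun N h => And.intro h.2 h.1
  have hN' : (0 : ℝ) < N := by exact_mod_cast hN0
  obtain ⟨u, hu, hφ⟩ := exists_norm_ge_forall_sum_sq_le hX N
  have hc : 0 < (N : ℝ) ^ (-β) := Real.rpow_pos_of_pos hN' _
  refine ⟨N, hN0, fun i => (((N : ℝ) ^ (-β) : ℝ) : 𝕜) • u i, fun φ => ?_, ?_⟩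
  · have h := sum_rpow_le_of_sum_sq_le (fun i => norm_nonneg (φ (u i))) (norm_nonneg φ) hs (hφ φ) hN0
    simp only [map_smul, norm_smul, RCLike.norm_ofReal, abs_of_pos hc]
    calc ∑ i, ((N : ℝ) ^ (-β) * ‖φ (u i)‖) ^ s
        = (N : ℝ) ^ (-β * s) * ∑ i, ‖φ (u i)‖ ^ s := by
          rw [Finset.mul_sum]
          refine Finset.sum_congr rfl fun i _ => ?_
          rw [Real.mul_rpow hc.le (norm_nonneg _), ← Real.rpow_mul hN'.le]
      _ ≤ (N : ℝ) ^ (-β * s) * ((N : ℝ) ^ (β * s) * ‖φ‖ ^ s) := by gcongr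
      _ = ‖φ‖ ^ s := by
          rw [← mul_assoc, ← Real.rpow_add hN']; simp
  · simp only [norm_smul, RCLike.norm_ofReal, abs_of_pos hc]
    calc B ≤ (N : ℝ) ^ ((1 / s - β) * p) / 4 ^ p := by
          rw [le_div_iff₀ (by positivity)]; exact hNB
      _ = ∑ i : Fin N, ((N : ℝ) ^ (-(1 / p - 1 / s)) * ((N : ℝ) ^ (-β) * (1 / 4))) ^ p := by
          rw [Finset.sum_const, Finset.card_univ, Fintype.card_fin, nsmul_eq_mul, ← mul_assoc,
            ← Real.rpow_add hN', Real.mul_rpow (by positivity) (by norm_num),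
            ← Real.rpow_mul hN'.le, ← mul_assoc, Real.div_rpow zero_le_one (by norm_num),
            Real.one_rpow, mul_one_div]
          congr 1
          nth_rewrite 2 [← Real.rpow_one (N : ℝ)]
          rw [← Real.rpow_add hN']
          congr 1
          field_simp
          ring
      _ ≤ _ := by
          gcongr with i
          exact hu i

/-- A family of vectors whose `q`-sums against functionals in the unit ball of the dual converge
uniformly. -/
def UniformlyWeakSummable (𝕜 : Type*) [RCLike 𝕜] {X : Type*} [NormedAddCommGroup X]
    [NormedSpace 𝕜 X] {ι : Type*} (q : ℝ) (y : ι → X) : Prop :=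
  ∀ ε : ℝ≥0∞, 0 < ε → ∃ F : Finset ι, ∀ φ : X →L[𝕜] 𝕜, ‖φ‖ ≤ 1 →
    ∑' i, (Set.indicator (F : Set ι)ᶜ (fun i => ‖φ (y i)‖ₑ ^ q) i) ≤ ε

theorem UniformlyWeakSummable.smul {ι : Type*} {q : ℝ} (hq : 0 ≤ q) {y : ι → X}
    (hy : UniformlyWeakSummable 𝕜 q y) {τ : ι → 𝕜} (hτ : ∀ i, ‖τ i‖ ≤ 1) :
    UniformlyWeakSummable 𝕜 q fun i => τ i • y i := by
  intro ε hε
  obtain ⟨F, hF⟩ := hy ε hε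
  refine ⟨F, fun φ hφ => (ENNReal.tsum_le_tsum fun i => ?_).trans (hF φ hφ)⟩
  refine Set.indicator_le_indicator ?_
  rw [map_smul, smul_eq_mul, enorm_mul]
  gcongr
  refine mul_le_of_le_one_left' ?_
  rw [← ofReal_norm]
  exact ENNReal.ofReal_le_one.2 (hτ i)

/-- Block m carries a factor 2^(-m) in both `τ` and `y`, which makes them summable in their
respective senses; the blocks are chosen so large that every p-sum stays at least 1. If p = s the
condition on r is vacuous and only the bound on `τ` remains, matching r = ∞. -/
theorem exists_uniformlyWeakSummable_smul_not_summable (hX : ¬ FiniteDimensional 𝕜 X) {p s : ℝ}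
    (hp : 0 < p) (hps : p ≤ s) :
    ∃ (τ : ℕ × ℕ → 𝕜) (y : ℕ × ℕ → X), (∀ i, ‖τ i‖ ≤ 1) ∧
      (∀ r : ℝ, 0 < r → 1 / r = 1 / p - 1 / s → Summable fun i => ‖τ i‖ ^ r) ∧
      UniformlyWeakSummable 𝕜 s y ∧ ¬ Summable fun i => ‖τ i • y i‖ ^ p := by
  have hs : 0 < s := hp.trans_le hps
  -- 4^m compensates the two factors 2^(-m).
  choose N hN v hv hB using fun m : ℕ => exists_weak_le_one_sum_rpow_ge hX hp hps ((4 ^ m : ℝ) ^ p)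
  have hN' : ∀ m, (0 : ℝ) < N m := fun m => by exact_mod_cast hN m
  have hN1 : ∀ m, (1 : ℝ) ≤ N m := fun m => by exact_mod_cast hN m
  have hρ : 0 ≤ 1 / p - 1 / s := sub_nonneg.2 (one_div_le_one_div_of_le hp hps)
  set ρ := 1 / p - 1 / s
  let t : ℕ → ℝ := fun m => (1 / 2) ^ m * (N m : ℝ) ^ (-ρ)
  have ht : ∀ m, 0 < t m := fun m => by have := hN' m; positivity
  let τ : ℕ × ℕ → 𝕜 := fun i => if i.2 < N i.1 then ((t i.1 : ℝ) : 𝕜) else 0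
  let y : ℕ × ℕ → X := fun i =>
    if h : i.2 < N i.1 then (((1 / 2 : ℝ) ^ i.1 : ℝ) : 𝕜) • v i.1 ⟨i.2, h⟩ else 0
  have hτ1 : ∀ m (i : Fin (N m)), ‖τ (m, i)‖ = t m := fun m i => by
    simp [τ, abs_of_pos (ht m)]
  have hy1 : ∀ m (i : Fin (N m)), y (m, i) = (((1 / 2 : ℝ) ^ m : ℝ) : 𝕜) • v m i := fun m i => by
    simp [y]
  have hτ0 : ∀ m i, i ∉ Finset.range (N m) → τ (m, i) = 0 := fun m i h => by
    simp only [Finset.mem_range] at h; simp [τ, h]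
  have hy0 : ∀ m i, i ∉ Finset.range (N m) → y (m, i) = 0 := fun m i h => by
    simp only [Finset.mem_range] at h; simp [y, h]
  have hgeom : ∀ q : ℝ, 0 < q → Summable fun m : ℕ => ((1 / 2 : ℝ) ^ m) ^ q := by
    intro q hq
    have : (fun m : ℕ => ((1 / 2 : ℝ) ^ m) ^ q) = fun m : ℕ => ((1 / 2 : ℝ) ^ q) ^ m := by
      funext m
      rw [← Real.rpow_natCast, ← Real.rpow_mul (by norm_num), mul_comm, Real.rpow_mul (by norm_num),
        Real.rpow_natCast]
    rw [this]
    exact summable_geometric_of_lt_one (by positivity)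
      (Real.rpow_lt_one (by norm_num) (by norm_num) hq)
  refine ⟨τ, y, ?_, ?_, ?_, ?_⟩
  · rintro ⟨m, i⟩
    by_cases h : i < N m
    · rw [hτ1 m ⟨i, h⟩]
      exact mul_le_one₀ (pow_le_one₀ (by norm_num) (by norm_num)) (by positivity)
        (Real.rpow_le_one_of_one_le_of_nonpos (hN1 m) (by linarith))
    · rw [hτ0 m i (by simpa using h)]; simp
  · intro r hr hrρ
    rw [summable_prod_of_nonneg fun i => by positivity]
    have h0 : ∀ m i, i ∉ Finset.range (N m) → ‖τ (m, i)‖ ^ r = 0 := fun m i h => by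
      rw [hτ0 m i h, norm_zero, Real.zero_rpow hr.ne']
    refine ⟨fun m => summable_of_ne_finset_zero (h0 m), ?_⟩
    refine (hgeom r hr).congr fun m => ?_
    rw [tsum_eq_sum (h0 m), Finset.sum_range]
    simp only [hτ1, Finset.sum_const, Finset.card_univ, Fintype.card_fin, nsmul_eq_mul, t]
    rw [Real.mul_rpow (by positivity) (by positivity), ← Real.rpow_mul (hN' m).le, ← hrρ]
    have : -(1 / r) * r = -1 := by field_simp
    rw [this, Real.rpow_neg_one]
    have := (hN' m).ne'
    field_simp
  · have hblock : ∀ φ : X →L[𝕜] 𝕜, ‖φ‖ ≤ 1 → ∀ m,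
        ∑' i, ‖φ (y (m, i))‖ₑ ^ s ≤ ENNReal.ofReal (((1 / 2 : ℝ) ^ m) ^ s) := by
      intro φ hφ m
      rw [tsum_eq_sum (s := Finset.range (N m)) (fun i h => by
        rw [hy0 m i h]; simp [hs]), Finset.sum_range]
      simp_rw [hy1, ← ofReal_norm, ENNReal.ofReal_rpow_of_nonneg (norm_nonneg _) hs.le]
      rw [← ENNReal.ofReal_sum_of_nonneg fun i _ => by positivity]
      refine ENNReal.ofReal_le_ofReal ?_
      have hc : (0 : ℝ) < (1 / 2) ^ m := by positivity
      simp only [map_smul, norm_smul, RCLike.norm_ofReal, abs_of_pos hc,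
        Real.mul_rpow hc.le (norm_nonneg _)]
      rw [← Finset.mul_sum]
      exact mul_le_of_le_one_right (by positivity)
        ((hv m φ).trans (Real.rpow_le_one (norm_nonneg _) hφ hs.le))
    intro ε hε
    have htail := ENNReal.tendsto_sum_nat_add
      (fun m => ENNReal.ofReal (((1 / 2 : ℝ) ^ m) ^ s)) (hgeom s hs).tsum_ofReal_ne_top
    obtain ⟨M, hM⟩ := ((ENNReal.tendsto_nhds_zero.1 htail) ε hε).exists
    -- The first M blocks have finitely many nonzero positions, and the remaining blocks contribute
    -- at most `ε`, uniformly in φ.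
    refine ⟨(Finset.range M).biUnion fun m => (Finset.range (N m)).image fun i => (m, i),
      fun φ hφ => ?_⟩
    rw [ENNReal.tsum_prod', ← Summable.sum_add_tsum_nat_add' (k := M) ENNReal.summable,
      Finset.sum_eq_zero, zero_add]
    · refine (ENNReal.tsum_le_tsum fun m => ?_).trans hM
      refine (ENNReal.tsum_le_tsum fun i => ?_).trans (hblock φ hφ (m + M))
      exact Set.indicator_le_self _ _ _
    · intro m hm
      rw [ENNReal.tsum_eq_zero]
      intro i
      by_cases hi : i < N m
      · refine Set.indicator_of_notMem ?_ _
        simp only [Set.mem_compl_iff, not_not, SetLike.mem_coe, Finset.mem_biUnion,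
          Finset.mem_image, Finset.mem_range, Prod.mk.injEq]
        exact ⟨m, Finset.mem_range.1 hm, i, hi, rfl, rfl⟩
      · refine Set.indicator_apply_eq_zero.2 fun _ => ?_
        rw [hy0 m i (by simpa using hi)]; simp [hs]
  · intro hsum
    -- Summability would force the block sums to tend to zero.
    have h1 := hsum.prod.tendsto_atTop_zero
    have h2 : ∀ m, 1 ≤ ∑' i, ‖τ (m, i) • y (m, i)‖ ^ p := by
      intro m
      rw [tsum_eq_sum (s := Finset.range (N m)) (fun i h => by
        rw [hy0 m i h, smul_zero, norm_zero, Real.zero_rpow hp.ne']), Finset.sum_range]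
      have hc : (0 : ℝ) < (1 / 2) ^ m := by positivity
      simp only [norm_smul, hτ1, hy1, RCLike.norm_ofReal, abs_of_pos hc]
      calc (1 : ℝ) = ((1 / 4) ^ m) ^ p * (4 ^ m) ^ p := by
            rw [← Real.mul_rpow (by positivity) (by positivity), ← mul_pow]; norm_num
        _ ≤ ((1 / 4) ^ m) ^ p * ∑ i, ((N m : ℝ) ^ (-ρ) * ‖v m i‖) ^ p := by
            gcongr; exact hB m
        _ = _ := by
            rw [Finset.mul_sum]
            refine Finset.sum_congr rfl fun i _ => ?_
            rw [← Real.mul_rpow (by positivity) (by positivity)]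
            congr 1
            have : (1 / 4 : ℝ) ^ m = (1 / 2) ^ m * (1 / 2) ^ m := by rw [← mul_pow]; norm_num
            simp only [t]
            rw [this]; ring
    have := ge_of_tendsto' h1 h2
    norm_num at this

end Blocks

/-! ### Extension by zero along an injection. -/

section Extension

variable {ι κ : Type*} {g : ι → κ}

theorem memℓp_extend_zero {Y : Type*} [NormedAddCommGroup Y] (hg : g.Injective)
    {f : ι → Y} {q : ℝ≥0∞} (hf : Memℓp f q) : Memℓp (Function.extend g f 0) q := by
  obtain rfl | rfl | hq := q.trichotomy
  · refine memℓp_zero (((memℓp_zero_iff.1 hf).image g).subset fun n hn => ?_)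
    by_cases h : ∃ i, g i = n
    · obtain ⟨i, rfl⟩ := h
      exact ⟨i, by simpa [hg.extend_apply] using hn, rfl⟩
    · exact absurd (Function.extend_apply' _ _ _ h) hn
  · obtain ⟨C, hC⟩ := memℓp_infty_iff.1 hf
    refine memℓp_infty ⟨max C 0, ?_⟩
    rintro _ ⟨n, rfl⟩
    by_cases h : ∃ i, g i = n
    · obtain ⟨i, rfl⟩ := h
      simp only [hg.extend_apply]
      exact (hC ⟨i, rfl⟩).trans (le_max_left _ _)
    · simp [Function.extend_apply' _ _ _ h]
  · refine memℓp_gen ?_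
    have : (fun n => ‖Function.extend g f 0 n‖ ^ q.toReal) =
        Function.extend g (fun i => ‖f i‖ ^ q.toReal) 0 := by
      funext n
      rw [Function.apply_extend (fun a : Y => ‖a‖ ^ q.toReal)]
      congr 1
      funext m
      simp [hq.ne']
    rw [this]
    exact ((hasSum_extend_zero hg).2 (hf.summable hq).hasSum).summable

end Extension

/-! ### Coordinate bounds and quasi-norm inequalities. -/

section Norms

variable {𝕜 : Type*} [RCLike 𝕜] {X : Type*} [NormedAddCommGroup X] [NormedSpace 𝕜 X]

theorem enorm_apply_le_scalarNorm {q : ℝ≥0∞} (hq : 0 < q) (a : ℕ → 𝕜) (n : ℕ) :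
    ‖a n‖ₑ ≤ scalarNorm q a := by
  rw [scalarNorm]
  split_ifs with h
  · exact le_iSup (fun n => ‖a n‖ₑ) n
  · have hq' : 0 < q.toReal := ENNReal.toReal_pos hq.ne' h
    rw [one_div, ENNReal.le_rpow_inv_iff hq']
    exact ENNReal.le_tsum (f := fun n => ‖a n‖ₑ ^ q.toReal) n

/-- Hahn–Banach supplies a norming functional for the n-th term. Norm convergence is thus
coordinatewise, which is all that closedness of V needs. -/
theorem enorm_apply_le_weakNorm {q : ℝ≥0∞} (hq : 0 < q) (x : ℕ → X) (n : ℕ) :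
    ‖x n‖ₑ ≤ weakNorm 𝕜 q x := by
  obtain ⟨φ, hφ, hφx⟩ := exists_dual_vector'' 𝕜 (x n)
  have h : ‖x n‖ₑ = ‖φ (x n)‖ₑ := by
    rw [hφx, ← ofReal_norm, ← ofReal_norm, RCLike.norm_ofReal, abs_norm]
  rw [h]
  exact (enorm_apply_le_scalarNorm hq (fun n => φ (x n)) n).trans
    (le_iSup₂ (f := fun (φ : X →L[𝕜] 𝕜) (_ : ‖φ‖ ≤ 1) => scalarNorm q fun n => φ (x n)) φ hφ)

theorem mixedExponent_pos {s p : ℝ≥0∞} (hp : 0 < p) : 0 < mixedExponent s p := by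
  rw [mixedExponent, ENNReal.inv_pos]
  exact ne_top_of_le_ne_top (ENNReal.inv_ne_top.2 hp.ne') tsub_le_self

theorem enorm_apply_le_mixedNorm {s p : ℝ≥0∞} (hp : 0 < p) (hps : p ≤ s) (x : ℕ → X) (n : ℕ) :
    ‖x n‖ₑ ≤ mixedNorm 𝕜 s p x := by
  refine le_iInf fun τ => le_iInf fun y => le_iInf fun h => ?_
  rw [h.2.2 n, enorm_smul]
  exact mul_le_mul' (enorm_apply_le_scalarNorm (mixedExponent_pos hp) τ n)
    (enorm_apply_le_weakNorm (hp.trans_le hps) y n)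

theorem weakNorm_le_iff {q : ℝ≥0∞} (hq : 0 < q) (hq' : q ≠ ∞) (x : ℕ → X) (c : ℝ≥0∞) :
    weakNorm 𝕜 q x ≤ c ↔
      ∀ φ : X →L[𝕜] 𝕜, ‖φ‖ ≤ 1 → ∑' n, ‖φ (x n)‖ₑ ^ q.toReal ≤ c ^ q.toReal := by
  simp only [weakNorm, iSup_le_iff, scalarNorm, if_neg hq', one_div,
    ENNReal.rpow_inv_le_iff (ENNReal.toReal_pos hq.ne' hq')]

theorem ennreal_add_rpow_le {q : ℝ} (hq : 0 ≤ q) (a b : ℝ≥0∞) :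
    (a + b) ^ q ≤ 2 ^ q * (a ^ q + b ^ q) := by
  have h1 : a + b ≤ 2 * max a b := by
    rw [two_mul]; exact add_le_add (le_max_left _ _) (le_max_right _ _)
  refine (ENNReal.rpow_le_rpow h1 hq).trans ?_
  rw [ENNReal.mul_rpow_of_nonneg _ _ hq]
  gcongr
  rcases max_choice a b with h | h <;> rw [h]
  · exact le_self_add
  · exact le_add_self

/-- `‖·‖_{w,q}` is a quasi-norm. -/
theorem weakNorm_add_le {q : ℝ≥0∞} (hq : 0 < q) (hq' : q ≠ ∞) (x y : ℕ → X) :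
    weakNorm 𝕜 q (fun n => x n + y n) ≤
      2 * 2 ^ (1 / q.toReal) * max (weakNorm 𝕜 q x) (weakNorm 𝕜 q y) := by
  have h0 : 0 < q.toReal := ENNReal.toReal_pos hq.ne' hq'
  rw [weakNorm_le_iff hq hq']
  intro φ hφ
  have hx := (weakNorm_le_iff hq hq' x _).1 (le_max_left _ (weakNorm 𝕜 q y)) φ hφ
  have hy := (weakNorm_le_iff hq hq' y _).1 (le_max_right (weakNorm 𝕜 q x) _) φ hφ
  set c := max (weakNorm 𝕜 q x) (weakNorm 𝕜 q y)
  calc ∑' n, ‖φ (x n + y n)‖ₑ ^ q.toReal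
      ≤ ∑' n, 2 ^ q.toReal * (‖φ (x n)‖ₑ ^ q.toReal + ‖φ (y n)‖ₑ ^ q.toReal) := by
        refine ENNReal.tsum_le_tsum fun n => ?_
        refine le_trans ?_ (ennreal_add_rpow_le h0.le _ _)
        rw [map_add]
        gcongr
        exact enorm_add_le _ _
    _ = 2 ^ q.toReal * (∑' n, ‖φ (x n)‖ₑ ^ q.toReal + ∑' n, ‖φ (y n)‖ₑ ^ q.toReal) := by
        rw [ENNReal.tsum_mul_left, ENNReal.tsum_add]
    _ ≤ 2 ^ q.toReal * (c ^ q.toReal + c ^ q.toReal) := by gcongr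
    _ = (2 * 2 ^ (1 / q.toReal) * c) ^ q.toReal := by
        rw [ENNReal.mul_rpow_of_nonneg _ _ h0.le, ENNReal.mul_rpow_of_nonneg _ _ h0.le,
          ← ENNReal.rpow_mul, one_div_mul_cancel h0.ne', ENNReal.rpow_one, ← two_mul]
        ring

theorem weakNorm_smul_le {q : ℝ≥0∞} (hq : 0 < q) (hq' : q ≠ ∞) (c : 𝕜) (x : ℕ → X) :
    weakNorm 𝕜 q (fun n => c • x n) ≤ ‖c‖ₑ * weakNorm 𝕜 q x := by
  have h0 : 0 < q.toReal := ENNReal.toReal_pos hq.ne' hq'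
  rw [weakNorm_le_iff hq hq']
  intro φ hφ
  simp only [map_smul, smul_eq_mul, enorm_mul, ENNReal.mul_rpow_of_nonneg _ _ h0.le]
  rw [ENNReal.tsum_mul_left]
  gcongr
  exact (weakNorm_le_iff hq hq' x _).1 le_rfl φ hφ

end Norms

/-! ### Linearity of the three spaces. -/

section Submodules

variable (𝕜 : Type*) [RCLike 𝕜] (X : Type*) [NormedAddCommGroup X] [NormedSpace 𝕜 X]

theorem smul_mem_weakEll {q : ℝ≥0∞} {y : ℕ → X} (hy : y ∈ weakEll 𝕜 q X) {c : ℕ → 𝕜}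
    (hc : ∀ n, ‖c n‖ ≤ 1) : (fun n => c n • y n) ∈ weakEll 𝕜 q X := fun φ =>
  (hy φ).mono' fun n => by
    rw [map_smul, norm_smul]
    exact mul_le_of_le_one_left (norm_nonneg _) (hc n)

/-- `ℓ_q^w(X)` as a linear space. -/
def weakSubmodule (q : ℝ≥0∞) : Submodule 𝕜 (ℕ → X) where
  carrier := weakEll 𝕜 q X
  zero_mem' φ := by simpa using zero_mem_ℓp'
  add_mem' hx hy φ := by simpa using! (hx φ).add (hy φ)
  smul_mem' c x hx φ := by simpa using! (hx φ).const_mul c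

/-- `ℓ_q^u(X)` as a linear space. -/
def uncondSubmodule (q : ℝ≥0∞) (hq : 0 < q) (hq' : q ≠ ∞) : Submodule 𝕜 (ℕ → X) where
  carrier := uncondEll 𝕜 q X
  zero_mem' := by
    refine ⟨(weakSubmodule 𝕜 X q).zero_mem, ?_⟩
    have : weakNorm 𝕜 q (fun _ : ℕ => (0 : X)) = 0 := by
      rw [← nonpos_iff_eq_zero, weakNorm_le_iff hq hq']
      simp [ENNReal.toReal_pos hq.ne' hq']
    simp [this]
  add_mem' {x y} hx hy := by
    refine ⟨(weakSubmodule 𝕜 X q).add_mem hx.1 hy.1, ?_⟩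
    have hc : (2 * 2 ^ (1 / q.toReal) : ℝ≥0∞) ≠ ∞ :=
      ENNReal.mul_ne_top (by simp) (ENNReal.rpow_ne_top_of_nonneg (by positivity) (by simp))
    have h := ENNReal.Tendsto.const_mul (hx.2.max hy.2) (Or.inr hc)
    rw [max_self, mul_zero] at h
    exact tendsto_of_tendsto_of_tendsto_of_le_of_le tendsto_const_nhds h (fun _ => zero_le)
      fun n => weakNorm_add_le hq hq' _ _
  smul_mem' c x hx := by
    refine ⟨(weakSubmodule 𝕜 X q).smul_mem c hx.1, ?_⟩
    have h := ENNReal.Tendsto.const_mul hx.2 (Or.inr (enorm_ne_top (x := c)))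
    rw [mul_zero] at h
    exact tendsto_of_tendsto_of_tendsto_of_le_of_le tendsto_const_nhds h (fun _ => zero_le)
      fun n => weakNorm_smul_le hq hq' _ _

/-- `ℓ_{m(s;p)}(X)` as a linear space. -/
def mixedSubmodule (s p : ℝ≥0∞) : Submodule 𝕜 (ℕ → X) where
  carrier := mixedEll 𝕜 s p X
  zero_mem' := ⟨0, 0, zero_memℓp, (weakSubmodule 𝕜 X s).zero_mem, fun n => by simp⟩
  add_mem' := by
    rintro x x' ⟨τ, y, hτ, hy, hx⟩ ⟨τ', y', hτ', hy', hx'⟩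
    -- A common majorant in ℓ_r: the quotients `τ n / σ n` and `τ' n / σ n` have modulus at most 1
    -- and are absorbed into `y` and `y'`. Where σ vanishes, so do τ and τ', and division by zero is
    -- harmless.
    let σ : ℕ → ℝ := fun n => ‖τ n‖ + ‖τ' n‖
    have hσ : ∀ n, 0 ≤ σ n := fun n => by positivity
    have hσ0 : ∀ n, ‖((σ n : ℝ) : 𝕜)‖ = σ n := fun n => by
      rw [RCLike.norm_ofReal, abs_of_nonneg (hσ n)]
    have hmem : Memℓp σ (mixedExponent s p) := hτ.norm.add hτ'.norm
    refine ⟨fun n => ((σ n : ℝ) : 𝕜),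
      (fun n => (τ n / ((σ n : ℝ) : 𝕜)) • y n) + (fun n => (τ' n / ((σ n : ℝ) : 𝕜)) • y' n),
      hmem.mono fun n => (hσ0 n).le, (weakSubmodule 𝕜 X s).add_mem
        (smul_mem_weakEll 𝕜 X hy fun n => ?_) (smul_mem_weakEll 𝕜 X hy' fun n => ?_), fun n => ?_⟩
    · rw [norm_div, hσ0]
      exact div_le_one_of_le₀ (le_add_of_nonneg_right (norm_nonneg _)) (hσ n)
    · rw [norm_div, hσ0]
      exact div_le_one_of_le₀ (le_add_of_nonneg_left (norm_nonneg _)) (hσ n)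
    · have hdiv : ∀ a : 𝕜, ‖a‖ ≤ σ n → ((σ n : ℝ) : 𝕜) * (a / ((σ n : ℝ) : 𝕜)) = a := by
        intro a ha
        refine mul_div_cancel_of_imp' fun h0 => norm_le_zero_iff.1 ?_
        rwa [RCLike.ofReal_eq_zero.1 h0] at ha
      simp only [Pi.add_apply, smul_add, smul_smul, hx n, hx' n]
      rw [hdiv _ (le_add_of_nonneg_right (norm_nonneg _)),
        hdiv _ (le_add_of_nonneg_left (norm_nonneg _))]
  smul_mem' := by
    rintro c x ⟨τ, y, hτ, hy, hx⟩
    exact ⟨τ, c • y, hτ, (weakSubmodule 𝕜 X s).smul_mem c hy, fun n => by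
      simp [hx n, smul_comm c]⟩

end Submodules

/-! ### The subspace of blockwise multiples, and membership of the copies. -/

section Spaceability

variable {𝕜 : Type*} [RCLike 𝕜] {X : Type*} [NormedAddCommGroup X] [NormedSpace 𝕜 X]

/-- A sequence space whose norm dominates the coordinates is spaceable off `ℓ_p(X)` as soon as it
contains infinitely many disjoint copies of a family outside `ℓ_p(X)`. -/
theorem spaceable_sdiff_ell (E : Submodule 𝕜 (ℕ → X)) {N : (ℕ → X) → ℝ≥0∞}
    (hN : ∀ z n, ‖z n‖ₑ ≤ N z) {ι : Type*} (e : ℕ × ι ≃ ℕ) {x : ι → X} {p : ℝ≥0∞}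
    (hp : 0 < p) (hp' : p ≠ ∞)
    (hxE : ∀ k, Function.extend (fun i => e (k, i)) x 0 ∈ E) (hx : ¬ Memℓp x p) :
    Spaceable 𝕜 (E : Set (ℕ → X)) N ((E : Set (ℕ → X)) \ ell p X) := by
  obtain ⟨i₀, hi₀⟩ : ∃ i, x i ≠ 0 := by
    by_contra! h
    exact hx ((funext h : x = 0) ▸ zero_memℓp)
  -- φ at position `i₀` reads off the scalar of each copy continuously, so the relations defining V
  -- are linear and closed.
  obtain ⟨φ, hφ⟩ : ∃ φ : X →L[𝕜] 𝕜, φ (x i₀) = 1 := SeparatingDual.exists_eq_one hi₀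
  have hinj : ∀ k, Function.Injective fun i => e (k, i) := fun k i j h => by simpa using h
  let V : Submodule 𝕜 (ℕ → X) :=
    { carrier := {z | z ∈ E ∧ ∀ k i, z (e (k, i)) = φ (z (e (k, i₀))) • x i}
      zero_mem' := ⟨E.zero_mem, fun k i => by simp⟩
      add_mem' := fun {z w} hz hw => ⟨E.add_mem hz.1 hw.1, fun k i => by
        simp only [Pi.add_apply, map_add, add_smul, ← hz.2 k i, ← hw.2 k i]⟩
      smul_mem' := fun c z hz => ⟨E.smul_mem c hz.1, fun k i => by
        simp only [Pi.smul_apply, map_smul, smul_eq_mul, mul_smul, ← hz.2 k i]⟩ }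
  have hcopy : ∀ k l i, Function.extend (fun i => e (k, i)) x 0 (e (l, i)) =
      (Pi.single k 1 : ℕ → 𝕜) l • x i := by
    intro k l i
    by_cases h : l = k
    · subst h
      rw [(hinj l).extend_apply]; simp
    · rw [Function.extend_apply' _ _ _ (by simp [Ne.symm h]), Pi.single_eq_of_ne h]
      simp
  refine ⟨V, fun z hz => hz.1, fun hfin => ?_, ?_, fun z hz => ?_⟩
  · let w : ℕ → V := fun k => ⟨Function.extend (fun i => e (k, i)) x 0, hxE k, fun l i => by
      rw [hcopy, hcopy, map_smul, hφ, smul_eq_mul, mul_one]⟩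
    let c : V →ₗ[𝕜] ℕ → 𝕜 :=
      { toFun := fun z l => φ (z.1 (e (l, i₀)))
        map_add' := fun z w => by funext l; simp
        map_smul' := fun a z => by funext l; simp }
    have hcw : c ∘ w = fun k => Pi.single k (1 : 𝕜) := by
      funext k l
      simp [c, w, hcopy, hφ]
    have hind : LinearIndependent 𝕜 w :=
      LinearIndependent.of_comp c (hcw ▸ Pi.linearIndependent_single_one ℕ 𝕜)
    exact Infinite.not_finite hind.finite
  · intro u z hu hz hlim
    have hcoord : ∀ n, Tendsto (fun k => u k n) atTop (𝓝 (z n)) := by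
      intro n
      rw [tendsto_iff_edist_tendsto_0]
      refine tendsto_of_tendsto_of_tendsto_of_le_of_le tendsto_const_nhds hlim
        (fun _ => zero_le) fun k => ?_
      rw [edist_eq_enorm_sub]
      exact hN (u k - z) n
    refine ⟨hz, fun k i => tendsto_nhds_unique (hcoord _) ?_⟩
    have h := (((φ.continuous.tendsto _).comp (hcoord (e (k, i₀)))).smul_const (x i))
    exact h.congr fun m => ((hu m).2 k i).symm
  · by_cases hzp : z ∈ ell p X
    · right
      have hc : ∀ k, φ (z (e (k, i₀))) = 0 := by
        intro k
        by_contra h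
        have hpr : 0 < p.toReal := ENNReal.toReal_pos hp.ne' hp'
        have h1 : Memℓp (fun i => z (e (k, i))) p :=
          (memℓp_gen_iff hpr).2 (((memℓp_gen_iff hpr).1 hzp).comp_injective (hinj k))
        -- Dividing copy k by its nonzero scalar recovers x, which would then lie in ℓ_p.
        have h2 := h1.const_smul (φ (z (e (k, i₀))))⁻¹
        refine hx (h2.mono' fun i => ?_)
        rw [Pi.smul_apply, hz.2 k i, inv_smul_smul₀ h]
      funext n
      obtain ⟨⟨k, i⟩, rfl⟩ := e.surjective n
      rw [hz.2 k i, hc k, zero_smul]; rfl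
    · exact Or.inl ⟨hz.1, hzp⟩

theorem UniformlyWeakSummable.memℓp {ι : Type*} {q : ℝ≥0∞} (hq : 0 < q) (hq' : q ≠ ∞) {y : ι → X}
    (hy : UniformlyWeakSummable 𝕜 q.toReal y) (φ : X →L[𝕜] 𝕜) : Memℓp (fun i => φ (y i)) q := by
  have h0 : 0 < q.toReal := ENNReal.toReal_pos hq.ne' hq'
  have key : ∀ ψ : X →L[𝕜] 𝕜, ‖ψ‖ ≤ 1 → Memℓp (fun i => ψ (y i)) q := by
    intro ψ hψ
    obtain ⟨F, hF⟩ := hy 1 one_pos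
    refine (memℓp_gen_iff h0).2 (F.summable_compl_iff.1 ?_)
    have h1 : ∑' i : {i // i ∉ F}, ‖ψ (y i)‖ₑ ^ q.toReal ≠ ∞ := by
      refine ne_top_of_le_ne_top ENNReal.one_ne_top (le_trans (le_of_eq ?_) (hF ψ hψ))
      exact tsum_subtype ((F : Set ι)ᶜ) fun i => ‖ψ (y i)‖ₑ ^ q.toReal
    refine (ENNReal.summable_toReal h1).congr fun i => ?_
    rw [← ENNReal.toReal_rpow, toReal_enorm]
  -- Rescaling into the unit ball; the added 1 covers φ = 0.
  have hc : 0 < ‖φ‖ + 1 := by positivity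
  have h1 := key ((((‖φ‖ + 1)⁻¹ : ℝ) : 𝕜) • φ) (by
    rw [norm_smul, RCLike.norm_ofReal, abs_of_pos (inv_pos.2 hc), inv_mul_le_iff₀ hc]
    linarith)
  have h2 := h1.const_mul (((‖φ‖ + 1 : ℝ)) : 𝕜)
  refine h2.mono' fun i => le_of_eq ?_
  have : (((‖φ‖ + 1 : ℝ)) : 𝕜) ≠ 0 := RCLike.ofReal_ne_zero.2 hc.ne'
  rw [smul_apply, smul_eq_mul, RCLike.ofReal_inv, mul_inv_cancel_left₀ this]

theorem UniformlyWeakSummable.extend_mem_weakEll {ι : Type*} {q : ℝ≥0∞} (hq : 0 < q) (hq' : q ≠ ∞)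
    {y : ι → X} (hy : UniformlyWeakSummable 𝕜 q.toReal y) {g : ι → ℕ} (hg : g.Injective) :
    Function.extend g y 0 ∈ weakEll 𝕜 q X := by
  intro φ
  have : (fun n => φ (Function.extend g y 0 n)) = Function.extend g (fun i => φ (y i)) 0 := by
    funext n
    rw [Function.apply_extend φ]
    congr 1
    funext m
    simp
  rw [this]
  exact memℓp_extend_zero hg (hy.memℓp hq hq' φ)

theorem UniformlyWeakSummable.extend_mem_uncondEll {ι : Type*} {q : ℝ≥0∞} (hq : 0 < q)
    (hq' : q ≠ ∞) {y : ι → X} (hy : UniformlyWeakSummable 𝕜 q.toReal y) {g : ι → ℕ}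
    (hg : g.Injective) : Function.extend g y 0 ∈ uncondEll 𝕜 q X := by
  have h0 : 0 < q.toReal := ENNReal.toReal_pos hq.ne' hq'
  refine ⟨hy.extend_mem_weakEll hq hq' hg, ENNReal.tendsto_nhds_zero.2 fun ε hε => ?_⟩
  obtain ⟨F, hF⟩ := hy (ε ^ q.toReal) (ENNReal.rpow_pos_of_nonneg hε h0.le)
  -- Beyond the largest position occupied by `F`, the tail meets only indices outside `F`.
  filter_upwards [eventually_gt_atTop (F.sup g)] with n hn
  rw [weakNorm_le_iff hq hq']
  intro φ hφ
  have hle : ∀ j, ‖φ (Function.extend g y 0 (n + j))‖ₑ ^ q.toReal ≤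
      Function.extend g ((F : Set ι)ᶜ.indicator fun i => ‖φ (y i)‖ₑ ^ q.toReal) 0 (n + j) := by
    intro j
    by_cases h : ∃ i, g i = n + j
    · obtain ⟨i, hi⟩ := h
      rw [← hi, hg.extend_apply, hg.extend_apply, Set.indicator_of_mem]
      intro hiF
      have : g i ≤ F.sup g := Finset.le_sup hiF
      omega
    · rw [Function.extend_apply' _ _ _ h]; simp [h0]
  calc ∑' j, ‖φ (Function.extend g y 0 (n + j))‖ₑ ^ q.toReal
      ≤ ∑' j, Function.extend g ((F : Set ι)ᶜ.indicator fun i => ‖φ (y i)‖ₑ ^ q.toReal) 0 (n + j) :=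
        ENNReal.tsum_le_tsum hle
    _ ≤ ∑' m, Function.extend g ((F : Set ι)ᶜ.indicator fun i => ‖φ (y i)‖ₑ ^ q.toReal) 0 m :=
        ENNReal.tsum_comp_le_tsum_of_injective (add_right_injective n) _
    _ ≤ ε ^ q.toReal := by rw [tsum_extend_zero hg]; exact hF φ hφ

theorem memℓp_mixedExponent {s p : ℝ≥0∞} (hp : 0 < p) (hps : p ≤ s) {ι : Type*}
    {τ : ι → 𝕜} (h1 : ∀ i, ‖τ i‖ ≤ 1)
    (hsum : ∀ r : ℝ, 0 < r → 1 / r = 1 / p.toReal - 1 / s.toReal → Summable fun i => ‖τ i‖ ^ r) :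
    Memℓp τ (mixedExponent s p) := by
  -- The exponent is infinite exactly when p = s.
  by_cases htop : mixedExponent s p = ∞
  · rw [htop]
    exact memℓp_infty ⟨1, by rintro _ ⟨i, rfl⟩; exact h1 i⟩
  · have hr := ENNReal.toReal_pos (mixedExponent_pos hp).ne' htop
    refine (memℓp_gen_iff hr).2 (hsum _ hr ?_)
    rw [mixedExponent, ENNReal.toReal_inv, one_div, inv_inv,
      ENNReal.toReal_sub_of_le (ENNReal.inv_le_inv.2 hps) (ENNReal.inv_ne_top.2 hp.ne'),
      ENNReal.toReal_inv, ENNReal.toReal_inv, one_div, one_div]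

end Spaceability

end SeqSpace

/-! ### The three spaceability statements. -/

theorem corollary3 {𝕜 : Type*} [RCLike 𝕜] {X : Type*} [NormedAddCommGroup X]
    [NormedSpace 𝕜 X] [CompleteSpace X] (hX : ¬ FiniteDimensional 𝕜 X)
    (p s : ENNReal) (hp : 0 < p) (hps : p ≤ s) (hs : s < ⊤) :
    SeqSpace.Spaceable 𝕜 (SeqSpace.mixedEll 𝕜 s p X) (SeqSpace.mixedNorm 𝕜 s p)
        (SeqSpace.mixedEll 𝕜 s p X \ SeqSpace.ell p X) ∧
      SeqSpace.Spaceable 𝕜 (SeqSpace.uncondEll 𝕜 p X) (SeqSpace.weakNorm 𝕜 p)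
        (SeqSpace.uncondEll 𝕜 p X \ SeqSpace.ell p X) ∧
      SeqSpace.Spaceable 𝕜 (SeqSpace.weakEll 𝕜 p X) (SeqSpace.weakNorm 𝕜 p)
        (SeqSpace.weakEll 𝕜 p X \ SeqSpace.ell p X) := by
  have hp' : p ≠ ⊤ := (hps.trans_lt hs).ne
  have hpr : 0 < p.toReal := ENNReal.toReal_pos hp.ne' hp'
  have hpsr : p.toReal ≤ s.toReal := ENNReal.toReal_mono hs.ne hps
  let e : ℕ × ℕ × ℕ ≃ ℕ := Denumerable.eqv _
  have hinj : ∀ k, Function.Injective fun i => e (k, i) := fun k i j h => by simpa using h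
  -- The case s = p: the products `τ i • y i` are themselves uniformly weakly p-summable, as needed
  -- for ℓ_p^u and ℓ_p^w.
  obtain ⟨τ, y, hτ, -, hy, hx⟩ :=
    SeqSpace.exists_uniformlyWeakSummable_smul_not_summable hX hpr le_rfl
  have hτy := hy.smul hpr.le hτ
  have hx' : ¬ Memℓp (fun i => τ i • y i) p := fun h => hx (h.summable hpr)
  refine ⟨?_, ?_, ?_⟩
  · obtain ⟨τ, y, hτ, hsum, hy, hx⟩ :=
      SeqSpace.exists_uniformlyWeakSummable_smul_not_summable hX hpr hpsr
    refine SeqSpace.spaceable_sdiff_ell (SeqSpace.mixedSubmodule 𝕜 X s p)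
      (SeqSpace.enorm_apply_le_mixedNorm hp hps) e (x := fun i => τ i • y i) hp hp'
      (fun k => ?_) fun h => hx (h.summable hpr)
    refine ⟨Function.extend (fun i => e (k, i)) τ 0, Function.extend (fun i => e (k, i)) y 0,
      SeqSpace.memℓp_extend_zero (hinj k) (SeqSpace.memℓp_mixedExponent hp hps hτ hsum),
      hy.extend_mem_weakEll (hp.trans_le hps) hs.ne (hinj k), fun n => ?_⟩
    by_cases h : ∃ i, e (k, i) = n
    · obtain ⟨i, rfl⟩ := h
      simp only [(hinj k).extend_apply]
    · simp only [Function.extend_apply' _ _ _ h, Pi.zero_apply, smul_zero]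
  · exact SeqSpace.spaceable_sdiff_ell (SeqSpace.uncondSubmodule 𝕜 X p hp hp')
      (SeqSpace.enorm_apply_le_weakNorm hp) e hp hp'
      (fun k => hτy.extend_mem_uncondEll hp hp' (hinj k)) hx'
  · exact SeqSpace.spaceable_sdiff_ell (SeqSpace.weakSubmodule 𝕜 X p)
      (SeqSpace.enorm_apply_le_weakNorm hp) e hp hp'
      (fun k => hτy.extend_mem_weakEll hp hp' (hinj k)) hx'
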